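/- Let $\mathcal{B}$ be a complete Boolean algebra with Stone space $Q$, let $C(Q)$ be the algebra of continuous functions $Q\to\mathbb{R}$, and let $L^0(\mathcal{B})=C_\infty(Q)$ be the algebra and vector lattice of all continuous functions $x\colon Q\to[-\infty,+\infty]$ that take the values $\pm\infty$ at most on a nowhere dense set; the order is pointwise, and the sum, product and real multiples are the unique elements of $C_\infty(Q)$ that agree with the pointwise ones wherever the functions involved are finite. Identify $e\in\mathcal{B}$ with the characteristic function of the corresponding clopen subset of $Q$, and for $x\in L^0(\mathcal{B})$ let $s(x)=\mathbf{1}-\sup\{e\in\mathcal{B}: ex=0\}$ be its support. A solid space in $L^0(\mathcal{B})$ is a non-zero linear subspace $Y$ such that $x\in Y$, $y\in L^0(\mathcal{B})$, $|y|\le|x|$ imply $y\in Y$. A monotone quasi-norm on $Y$ is a map $\|\cdot\|_Y\colon Y\to[0,\infty)$ with $\|x\|_Y=0$ if and only if $x=0$, with $\|\alpha x\|_Y=|\alpha|\,\|x\|_Y$ for $\alpha\in\mathbb{R}$, with $\|x+y\|_Y\le C(\|x\|_Y+\|y\|_Y)$ for some constant $C\ge 1$ and all $x,y\in Y$, and with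 $\|y\|_Y\le\|x\|_Y$ whenever $|y|\le|x|$. **Theorem.** Let $X$ be an ideal in $C(Q)$ and let $Y$ be a solid space in $L^0(\mathcal{B})$ that carries a monotone quasi-norm. Let $\delta\colon X\to Y$ be a band preserving derivation, that is, a real-linear map with $\delta(xy)=\delta(x)y+x\delta(y)$ for all $x,y\in X$ and $s(\delta(x))\le s(x)$ for all $x\in X$. Then $\delta=0$. -/

import Mathlib

open Set Filter Topology

noncomputable section

universe u

/-! ### The Stone space of a Boolean algebra -/

/-- The Stone space of a Boolean algebra `B`: its points are the two-valued homomorphisms on `B`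
(equivalently, the ultrafilters of `B`), with the topology of pointwise convergence. -/
def StoneSpace (B : Type u) [BooleanAlgebra B] : Type u := BoundedLatticeHom B Bool

namespace StoneSpace

variable {B : Type u} [BooleanAlgebra B]

/-- The value of the two-valued homomorphism `t` at `b`. -/
def val (t : StoneSpace B) (b : B) : Bool := BoundedLatticeHom.toLatticeHom t b

instance : TopologicalSpace (StoneSpace B) := TopologicalSpace.induced val inferInstance

theorem val_injective : Function.Injective (val (B := B)) := by
  intro s t h
  exact DFunLike.coe_injective (F := BoundedLatticeHom B Bool) h

theorem continuous_val : Continuous (val (B := B)) := continuous_induced_dom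

@[simp] theorem val_top (t : StoneSpace B) : t.val ⊤ = true := map_top (F := BoundedLatticeHom B Bool) t
@[simp] theorem val_bot (t : StoneSpace B) : t.val ⊥ = false := map_bot (F := BoundedLatticeHom B Bool) t
@[simp] theorem val_inf (t : StoneSpace B) (a b : B) : t.val (a ⊓ b) = (t.val a && t.val b) :=
  map_inf (F := BoundedLatticeHom B Bool) t a b
@[simp] theorem val_sup (t : StoneSpace B) (a b : B) : t.val (a ⊔ b) = (t.val a || t.val b) :=
  map_sup (F := BoundedLatticeHom B Bool) t a b

theorem val_mono (t : StoneSpace B) {a b : B} (h : a ≤ b) (ha : t.val a = true) :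
    t.val b = true := by
  have := t.val_sup a b
  rw [sup_eq_right.2 h, ha] at this
  simpa using this

@[simp] theorem val_compl (t : StoneSpace B) (a : B) : t.val aᶜ = !t.val a := by
  have h1 := t.val_inf a aᶜ
  have h2 := t.val_sup a aᶜ
  rw [inf_compl_eq_bot, val_bot] at h1
  rw [sup_compl_eq_top, val_top] at h2
  revert h1 h2
  cases t.val a <;> cases t.val aᶜ <;> simp

instance : T2Space (StoneSpace B) := T2Space.of_injective_continuous val_injective continuous_val

theorem range_val : range (val (B := B)) = {f : B → Bool | f ⊤ = true ∧ f ⊥ = false ∧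
    ∀ a b, f (a ⊓ b) = (f a && f b) ∧ f (a ⊔ b) = (f a || f b)} := by
  ext f
  constructor
  · rintro ⟨t, rfl⟩
    exact ⟨t.val_top, t.val_bot, fun a b => ⟨t.val_inf a b, t.val_sup a b⟩⟩
  · rintro ⟨h1, h2, h3⟩
    refine ⟨(⟨⟨⟨f, fun a b => (h3 a b).2⟩, fun a b => (h3 a b).1⟩, h1, h2⟩ :
      BoundedLatticeHom B Bool), rfl⟩

theorem isClosed_range_val : IsClosed (range (val (B := B))) := by
  have hev : ∀ a : B, Continuous fun f : B → Bool => f a := fun a => continuous_apply a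
  have hand : ∀ a b : B, Continuous fun f : B → Bool => (f a && f b) := fun a b =>
    (continuous_of_discreteTopology (f := fun p : Bool × Bool => (p.1 && p.2))).comp
      ((hev a).prodMk (hev b))
  have hor : ∀ a b : B, Continuous fun f : B → Bool => (f a || f b) := fun a b =>
    (continuous_of_discreteTopology (f := fun p : Bool × Bool => (p.1 || p.2))).comp
      ((hev a).prodMk (hev b))
  rw [range_val]
  simp only [ofPred_and, ofPred_forall]
  exact (isClosed_eq (hev _) continuous_const).inter ((isClosed_eq (hev _) continuous_const).inter
    (isClosed_iInter fun a => isClosed_iInter fun b =>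
      (isClosed_eq (hev _) (hand a b)).inter (isClosed_eq (hev _) (hor a b))))

instance : CompactSpace (StoneSpace B) :=
  (IsClosedEmbedding.mk ⟨⟨rfl⟩, val_injective⟩ isClosed_range_val).compactSpace

/-- The clopen subset `Q(e)` of the Stone space corresponding to `e`. -/
def basic (e : B) : Set (StoneSpace B) := {t | t.val e = true}

@[simp] theorem mem_basic {e : B} {t : StoneSpace B} : t ∈ basic e ↔ t.val e = true := Iff.rfl

theorem isClopen_basic (e : B) : IsClopen (basic e) :=
  (isClopen_discrete {true}).preimage ((continuous_apply e).comp continuous_val)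

theorem exists_basic_subset {t : StoneSpace B} {U : Set (StoneSpace B)} (hU : IsOpen U)
    (ht : t ∈ U) : ∃ e : B, t ∈ basic e ∧ basic e ⊆ U := by
  obtain ⟨V, hV, rfl⟩ := isOpen_induced_iff.1 hU
  obtain ⟨I, u, hu, hsub⟩ := isOpen_pi_iff.1 hV t.val ht
  let c : B → B := fun b => if t.val b = true then b else bᶜ
  have hc : ∀ b, t.val (c b) = true := by
    intro b
    by_cases h : t.val b = true <;> simp [c, h]
  have hinf : ∀ (s : StoneSpace B) (J : Finset B),
      s.val (J.inf c) = true ↔ ∀ b ∈ J, s.val (c b) = true := by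
    intro s J
    classical
    induction J using Finset.induction_on with
    | empty => simp
    | insert a J ha ih => simp [Finset.inf_insert, ih]
  refine ⟨I.inf c, (hinf t I).2 fun b _ => hc b, fun s hs => hsub ?_⟩
  intro b hb
  have h := (hinf s I).1 hs b hb
  have : s.val b = t.val b := by
    by_cases hb' : t.val b = true
    · simpa [c, hb'] using h
    · simpa [c, hb'] using h
  rw [this]
  exact (hu b hb).2

theorem exists_mem_basic {e : B} (he : e ≠ ⊥) : ∃ t : StoneSpace B, t ∈ basic e := by
  obtain ⟨J, hJ, -, hd⟩ := DistribLattice.prime_ideal_of_disjoint_filter_ideal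
    (F := Order.PFilter.principal e) (I := Order.Ideal.principal (⊥ : B)) (by
      rw [Set.disjoint_left]
      intro x hx hx'
      have h1 : e ≤ x := hx
      have h2 : x ≤ ⊥ := hx'
      exact he (le_bot_iff.1 (h1.trans h2)))
  classical
  have heJ : e ∉ J := fun h => Set.disjoint_left.1 hd (show e ≤ e from le_rfl) h
  have htop : (⊤ : B) ∉ J := fun h => heJ (J.lower le_top h)
  have hinf : ∀ a b : B, a ⊓ b ∈ J ↔ a ∈ J ∨ b ∈ J := fun a b =>
    ⟨fun h => hJ.mem_or_mem h, fun h => h.elim (fun h => J.lower inf_le_left h)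
      (fun h => J.lower inf_le_right h)⟩
  have hmem : (fun b : B => decide (b ∉ J)) ∈ range (val (B := B)) := by
    rw [range_val]
    refine ⟨by simpa using htop, by simp, fun a b => ⟨?_, ?_⟩⟩
    · by_cases ha : a ∈ J <;> by_cases hb : b ∈ J <;> simp [hinf, ha, hb]
    · by_cases ha : a ∈ J <;> by_cases hb : b ∈ J <;> simp [Order.Ideal.sup_mem_iff, ha, hb]
  obtain ⟨t, ht⟩ := hmem
  exact ⟨t, by simp [ht, heJ]⟩

instance {B : Type u} [CompleteBooleanAlgebra B] : ExtremallyDisconnected (StoneSpace B) where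
  open_closure U hU := by
    let e : B := sSup {b | basic b ⊆ U}
    suffices h : closure U = basic e by rw [h]; exact (isClopen_basic e).isOpen
    apply Subset.antisymm
    · refine closure_minimal (fun t ht => ?_) (isClopen_basic e).isClosed
      obtain ⟨b, hb, hbU⟩ := exists_basic_subset hU ht
      exact t.val_mono (le_sSup (show b ∈ {b | basic b ⊆ U} from hbU)) hb
    · intro t ht
      rw [mem_closure_iff]
      intro V hV htV
      obtain ⟨c, hc, hcV⟩ := exists_basic_subset hV htV
      by_contra hne
      have hce : c ⊓ e = ⊥ := by
        rw [inf_sSup_eq]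
        refine iSup₂_eq_bot.2 fun b hb => ?_
        by_contra h
        obtain ⟨s, hs⟩ := exists_mem_basic h
        simp only [mem_basic, val_inf, Bool.and_eq_true] at hs
        exact hne ⟨s, hcV hs.1, hb hs.2⟩
      have := t.val_inf c e
      rw [hce, val_bot] at this
      simp only [mem_basic] at hc ht
      simp [hc, ht] at this

end StoneSpace

/-! ### The algebra `C_∞(Q)` of extended continuous functions -/

/-- `C_∞(Q)`: the continuous functions `Q → [-∞, +∞]` that take the values `±∞` at most on a
nowhere dense set. -/
structure CInfty (Q : Type u) [TopologicalSpace Q] : Type u where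
  /-- the underlying function -/
  toFun : Q → EReal
  continuous_toFun : Continuous toFun
  isNowhereDense_infinite : IsNowhereDense {t | toFun t = ⊥ ∨ toFun t = ⊤}

namespace CInfty

section Basic

variable {Q : Type u} [TopologicalSpace Q]

instance : CoeFun (CInfty Q) (fun _ => Q → EReal) := ⟨toFun⟩

@[ext] theorem ext {x y : CInfty Q} (h : ∀ t, x t = y t) : x = y := by
  cases x; cases y; congr; exact funext h

/-- The set of points at which `x` is finite. -/
def finSet (x : CInfty Q) : Set Q := {t | x t ≠ ⊥ ∧ x t ≠ ⊤}

theorem compl_finSet (x : CInfty Q) : x.finSetᶜ = {t | x t = ⊥ ∨ x t = ⊤} := by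
  ext t; simp only [finSet, mem_compl_iff, mem_ofPred_eq]; tauto

theorem isOpen_finSet (x : CInfty Q) : IsOpen x.finSet :=
  (isOpen_ne_fun x.continuous_toFun continuous_const).inter
    (isOpen_ne_fun x.continuous_toFun continuous_const)

theorem dense_finSet (x : CInfty Q) : Dense x.finSet := by
  have h := x.isNowhereDense_infinite
  rw [← compl_finSet, x.isOpen_finSet.isClosed_compl.isNowhereDense_iff,
    interior_eq_empty_iff_dense_compl, compl_compl] at h
  exact h

theorem isNowhereDense_of_dense {f : Q → EReal} (hf : Continuous f)
    (h : Dense {t | f t ≠ ⊥ ∧ f t ≠ ⊤}) : IsNowhereDense {t | f t = ⊥ ∨ f t = ⊤} := by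
  have hc : IsClosed {t | f t = ⊥ ∨ f t = ⊤} :=
    (isClosed_eq hf continuous_const).union (isClosed_eq hf continuous_const)
  rw [hc.isNowhereDense_iff, interior_eq_empty_iff_dense_compl]
  convert h using 1
  ext t; simp

theorem coe_toReal {x : CInfty Q} {t : Q} (ht : t ∈ x.finSet) : ((x t).toReal : EReal) = x t :=
  EReal.coe_toReal ht.2 ht.1

theorem continuousOn_toReal (x : CInfty Q) : ContinuousOn (fun t => (x t).toReal) x.finSet :=
  EReal.continuousOn_toReal.comp x.continuous_toFun.continuousOn fun t ht => by
    simpa [finSet] using ht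

/-- Every (finite) continuous real function is an element of `C_∞(Q)`. -/
def ofReal (f : C(Q, ℝ)) : CInfty Q where
  toFun t := (f t : EReal)
  continuous_toFun := continuous_coe_real_ereal.comp f.continuous
  isNowhereDense_infinite := by simp

@[simp] theorem ofReal_apply (f : C(Q, ℝ)) (t : Q) : ofReal f t = (f t : EReal) := rfl

instance : Zero (CInfty Q) := ⟨ofReal 0⟩

instance : One (CInfty Q) := ⟨ofReal 1⟩

/-- Negation is pointwise. -/
instance : Neg (CInfty Q) where
  neg x :=
    { toFun := fun t => -x t
      continuous_toFun := continuous_neg.comp x.continuous_toFun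
      isNowhereDense_infinite := by
        have h : {t | -x t = ⊥ ∨ -x t = ⊤} = {t | x t = ⊥ ∨ x t = ⊤} := by
          ext t; simp only [mem_ofPred_eq, EReal.neg_eq_bot_iff, EReal.neg_eq_top_iff]; tauto
        rw [h]
        exact x.isNowhereDense_infinite }

/-- The order is pointwise. -/
instance : PartialOrder (CInfty Q) where
  le x y := ∀ t, x t ≤ y t
  le_refl x t := le_rfl
  le_trans x y z h h' t := (h t).trans (h' t)
  le_antisymm x y h h' := ext fun t => le_antisymm (h t) (h' t)

/-- Suprema and infima of two elements are pointwise. -/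
instance : Lattice (CInfty Q) where
  sup x y :=
    { toFun := fun t => x t ⊔ y t
      continuous_toFun := x.continuous_toFun.sup y.continuous_toFun
      isNowhereDense_infinite := isNowhereDense_of_dense
        (x.continuous_toFun.sup y.continuous_toFun)
        ((x.dense_finSet.inter_of_isOpen_left y.dense_finSet x.isOpen_finSet).mono
          fun t ht => by
            rcases le_total (x t) (y t) with h | h
            · rw [mem_ofPred_eq, sup_eq_right.2 h]; exact ht.2
            · rw [mem_ofPred_eq, sup_eq_left.2 h]; exact ht.1) }
  inf x y :=
    { toFun := fun t => x t ⊓ y t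
      continuous_toFun := x.continuous_toFun.inf y.continuous_toFun
      isNowhereDense_infinite := isNowhereDense_of_dense
        (x.continuous_toFun.inf y.continuous_toFun)
        ((x.dense_finSet.inter_of_isOpen_left y.dense_finSet x.isOpen_finSet).mono
          fun t ht => by
            rcases le_total (x t) (y t) with h | h
            · rw [mem_ofPred_eq, inf_eq_left.2 h]; exact ht.1
            · rw [mem_ofPred_eq, inf_eq_right.2 h]; exact ht.2) }
  le_sup_left x y t := le_sup_left
  le_sup_right x y t := le_sup_right
  sup_le x y z h h' t := sup_le (h t) (h' t)
  inf_le_left x y t := inf_le_left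
  inf_le_right x y t := inf_le_right
  le_inf x y z h h' t := le_inf (h t) (h' t)

theorem neg_apply (x : CInfty Q) (t : Q) : (-x) t = -x t := rfl

/-- The germ of an element of `C_∞(Q)`, as a real function defined up to a meagre set. -/
def toGerm (x : CInfty Q) : (residual Q).Germ ℝ := ((fun t => (x t).toReal : Q → ℝ) : Germ _ ℝ)

theorem eventually_finSet (x : CInfty Q) : ∀ᶠ t in residual Q, t ∈ x.finSet :=
  residual_of_dense_open x.isOpen_finSet x.dense_finSet

theorem toGerm_neg (x : CInfty Q) : toGerm (-x) = -toGerm x :=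
  Germ.coe_eq.2 <| by
    filter_upwards with t
    simp [neg_apply]

theorem toGerm_ofReal (f : C(Q, ℝ)) : toGerm (ofReal f) = ((f : Q → ℝ) : Germ _ ℝ) := rfl

theorem toGerm_zero : toGerm (0 : CInfty Q) = 0 := rfl

theorem toGerm_one : toGerm (1 : CInfty Q) = 1 := rfl

end Basic

variable {Q : Type u} [TopologicalSpace Q] [CompactSpace Q] [T2Space Q] [ExtremallyDisconnected Q]

/-- A continuous extended-real function on a dense open subset of an extremally disconnected
compact space extends continuously to the whole space. -/
theorem exists_continuous_extension {U : Set Q} (hU : IsOpen U) (hd : Dense U) {g : Q → EReal}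
    (hg : ContinuousOn g U) : ∃ f : Q → EReal, Continuous f ∧ ∀ t ∈ U, f t = g t := by
  let G : Set (Q × EReal) := (fun t => (t, g t)) '' U
  let K : Set (Q × EReal) := closure G
  have hKc : IsCompact K := isClosed_closure.isCompact
  have : CompactSpace K := isCompact_iff_compactSpace.1 hKc
  have hπ : Continuous fun p : K => p.1.1 := continuous_fst.comp continuous_subtype_val
  have hsurj : Function.Surjective fun p : K => p.1.1 := by
    have hcl : IsClosed (Prod.fst '' K) := (hKc.image continuous_fst).isClosed
    have hsub : U ⊆ Prod.fst '' K := fun t ht => ⟨(t, g t), subset_closure ⟨t, ht, rfl⟩, rfl⟩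
    intro t
    obtain ⟨p, hp, rfl⟩ := hcl.closure_subset_iff.2 hsub (hd t)
    exact ⟨⟨p, hp⟩, rfl⟩
  obtain ⟨s, hs, hsπ⟩ := CompactT2.ExtremallyDisconnected.projective (A := Q) continuous_id hπ hsurj
  refine ⟨fun t => (s t).1.2, continuous_snd.comp (continuous_subtype_val.comp hs), fun t ht => ?_⟩
  have h1 : (s t).1.1 = t := congrFun hsπ t
  have hcont : ContinuousWithinAt (fun p : Q × EReal => (g p.1, p.2)) G (s t).1 := by
    apply ContinuousAt.continuousWithinAt
    have hgt : ContinuousAt g (s t).1.1 := by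
      rw [h1]; exact hg.continuousAt (hU.mem_nhds ht)
    exact (ContinuousAt.comp (f := Prod.fst) (x := (s t).1) hgt continuousAt_fst).prodMk
      continuousAt_snd
  have hmem : (g (s t).1.1, (s t).1.2) ∈ closure (diagonal EReal) :=
    hcont.mem_closure (s t).2 (by rintro _ ⟨r, -, rfl⟩; rfl)
  rw [isClosed_diagonal.closure_eq] at hmem
  have : g (s t).1.1 = (s t).1.2 := hmem
  rw [h1] at this
  exact this.symm

theorem exists_extension {U : Set Q} (hU : IsOpen U) (hd : Dense U) {g : Q → ℝ}
    (hg : ContinuousOn g U) : ∃ z : CInfty Q, ∀ t ∈ U, z t = (g t : EReal) := by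
  obtain ⟨f, hf, hfg⟩ := exists_continuous_extension hU hd
    (continuous_coe_real_ereal.comp_continuousOn hg)
  refine ⟨⟨f, hf, isNowhereDense_of_dense hf (hd.mono fun t ht => ?_)⟩, hfg⟩
  simp [hfg t ht]

theorem exists_add (x y : CInfty Q) : ∃ z : CInfty Q, ∀ t ∈ x.finSet ∩ y.finSet,
    z t = (((x t).toReal + (y t).toReal : ℝ) : EReal) :=
  exists_extension (x.isOpen_finSet.inter y.isOpen_finSet)
    (x.dense_finSet.inter_of_isOpen_left y.dense_finSet x.isOpen_finSet)
    ((x.continuousOn_toReal.mono inter_subset_left).add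
      (y.continuousOn_toReal.mono inter_subset_right))

theorem exists_mul (x y : CInfty Q) : ∃ z : CInfty Q, ∀ t ∈ x.finSet ∩ y.finSet,
    z t = (((x t).toReal * (y t).toReal : ℝ) : EReal) :=
  exists_extension (x.isOpen_finSet.inter y.isOpen_finSet)
    (x.dense_finSet.inter_of_isOpen_left y.dense_finSet x.isOpen_finSet)
    ((x.continuousOn_toReal.mono inter_subset_left).mul
      (y.continuousOn_toReal.mono inter_subset_right))

theorem exists_smul (c : ℝ) (x : CInfty Q) : ∃ z : CInfty Q, ∀ t ∈ x.finSet,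
    z t = ((c * (x t).toReal : ℝ) : EReal) :=
  exists_extension x.isOpen_finSet x.dense_finSet (continuousOn_const.mul x.continuousOn_toReal)

/-- The sum: the (unique) element of `C_∞(Q)` that is the pointwise sum wherever both summands
are finite. -/
instance : Add (CInfty Q) := ⟨fun x y => (exists_add x y).choose⟩

/-- The product: the (unique) element of `C_∞(Q)` that is the pointwise product wherever both
factors are finite. -/
instance : Mul (CInfty Q) := ⟨fun x y => (exists_mul x y).choose⟩

/-- The scalar multiple: the (unique) element of `C_∞(Q)` that is the pointwise multiple wherever
`x` is finite. -/
instance : SMul ℝ (CInfty Q) := ⟨fun c x => (exists_smul c x).choose⟩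

theorem add_apply (x y : CInfty Q) {t : Q} (hx : t ∈ x.finSet) (hy : t ∈ y.finSet) :
    (x + y) t = (((x t).toReal + (y t).toReal : ℝ) : EReal) :=
  (exists_add x y).choose_spec t ⟨hx, hy⟩

theorem mul_apply (x y : CInfty Q) {t : Q} (hx : t ∈ x.finSet) (hy : t ∈ y.finSet) :
    (x * y) t = (((x t).toReal * (y t).toReal : ℝ) : EReal) :=
  (exists_mul x y).choose_spec t ⟨hx, hy⟩

theorem smul_apply (c : ℝ) (x : CInfty Q) {t : Q} (hx : t ∈ x.finSet) :
    (c • x) t = ((c * (x t).toReal : ℝ) : EReal) :=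
  (exists_smul c x).choose_spec t hx

theorem toGerm_injective : Function.Injective (toGerm (Q := Q)) := by
  intro x y h
  have h' : ∀ᶠ t in residual Q, (x t).toReal = (y t).toReal := Germ.coe_eq.1 h
  have hd : Dense {t | x t = y t} := by
    apply dense_of_mem_residual
    filter_upwards [h', x.eventually_finSet, y.eventually_finSet] with t ht hx hy
    rw [← coe_toReal hx, ← coe_toReal hy, ht]
  have hc := (isClosed_eq x.continuous_toFun y.continuous_toFun).closure_eq
  exact ext fun t => hc.subset (hd t)

theorem toGerm_add (x y : CInfty Q) : toGerm (x + y) = toGerm x + toGerm y :=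
  Germ.coe_eq.2 <| by
    filter_upwards [x.eventually_finSet, y.eventually_finSet] with t hx hy
    rw [add_apply x y hx hy, EReal.toReal_coe]

theorem toGerm_mul (x y : CInfty Q) : toGerm (x * y) = toGerm x * toGerm y :=
  Germ.coe_eq.2 <| by
    filter_upwards [x.eventually_finSet, y.eventually_finSet] with t hx hy
    rw [mul_apply x y hx hy, EReal.toReal_coe]

theorem toGerm_smul (c : ℝ) (x : CInfty Q) : toGerm (c • x) = c • toGerm x :=
  Germ.coe_eq.2 <| by
    filter_upwards [x.eventually_finSet] with t hx
    rw [smul_apply c x hx, EReal.toReal_coe]; rfl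

theorem ofReal_add (f g : C(Q, ℝ)) : ofReal (f + g) = ofReal f + ofReal g :=
  toGerm_injective (by rw [toGerm_add]; rfl)

theorem ofReal_mul (f g : C(Q, ℝ)) : ofReal (f * g) = ofReal f * ofReal g :=
  toGerm_injective (by rw [toGerm_mul]; rfl)

theorem ofReal_smul (c : ℝ) (f : C(Q, ℝ)) : ofReal (c • f) = c • ofReal f :=
  toGerm_injective (by rw [toGerm_smul]; rfl)

instance : CommRing (CInfty Q) where
  add_assoc x y z := toGerm_injective (by simp only [toGerm_add, add_assoc])
  zero_add x := toGerm_injective (by simp only [toGerm_add, toGerm_zero, zero_add])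
  add_zero x := toGerm_injective (by simp only [toGerm_add, toGerm_zero, add_zero])
  add_comm x y := toGerm_injective (by simp only [toGerm_add, add_comm])
  nsmul := nsmulRec
  zsmul := zsmulRec
  left_distrib x y z := toGerm_injective (by simp only [toGerm_add, toGerm_mul, mul_add])
  right_distrib x y z := toGerm_injective (by simp only [toGerm_add, toGerm_mul, add_mul])
  zero_mul x := toGerm_injective (by simp only [toGerm_mul, toGerm_zero, zero_mul])
  mul_zero x := toGerm_injective (by simp only [toGerm_mul, toGerm_zero, mul_zero])
  mul_assoc x y z := toGerm_injective (by simp only [toGerm_mul, mul_assoc])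
  one_mul x := toGerm_injective (by simp only [toGerm_mul, toGerm_one, one_mul])
  mul_one x := toGerm_injective (by simp only [toGerm_mul, toGerm_one, mul_one])
  neg_add_cancel x := toGerm_injective (by
    simp only [toGerm_add, toGerm_neg, toGerm_zero, neg_add_cancel])
  mul_comm x y := toGerm_injective (by simp only [toGerm_mul, mul_comm])

instance : Module ℝ (CInfty Q) where
  one_smul x := toGerm_injective (by simp only [toGerm_smul, one_smul])
  mul_smul a b x := toGerm_injective (by simp only [toGerm_smul, mul_smul])
  smul_zero a := toGerm_injective (by simp only [toGerm_smul, toGerm_zero, smul_zero])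
  smul_add a x y := toGerm_injective (by simp only [toGerm_smul, toGerm_add, smul_add])
  add_smul a b x := toGerm_injective (by simp only [toGerm_smul, toGerm_add, add_smul])
  zero_smul x := toGerm_injective (by simp only [toGerm_smul, toGerm_zero, zero_smul])

end CInfty

/-! ### The algebra `L⁰(B)`, supports, solid spaces, derivations -/

/-- `L⁰(B) = C_∞(Q)` where `Q` is the Stone space of the complete Boolean algebra `B`. -/
abbrev LZero (B : Type u) [CompleteBooleanAlgebra B] : Type u := CInfty (StoneSpace B)

variable {B : Type u} [CompleteBooleanAlgebra B]

open Classical in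
/-- The idempotent of `L⁰(B)` corresponding to `e ∈ B`: the characteristic function of the clopen
set `Q(e)`. -/
def idem (e : B) : LZero B :=
  CInfty.ofReal ⟨(StoneSpace.basic e).indicator 1,
    continuous_one.indicator (by simp [(StoneSpace.isClopen_basic e).frontier_eq])⟩

/-- The support `s(x) = 1 - sup {e ∈ B : e x = 0}`. -/
def supp (x : LZero B) : B := (sSup {e : B | idem e * x = 0})ᶜ

/-- A solid space in `L⁰(B)`: a nonzero linear subspace `Y` with `y ∈ Y` whenever `x ∈ Y` and
`|y| ≤ |x|`. -/
structure IsSolidSpace (Y : Submodule ℝ (LZero B)) : Prop where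
  ne_bot : Y ≠ ⊥
  solid : ∀ x ∈ Y, ∀ y : LZero B, |y| ≤ |x| → y ∈ Y

/-- `N` is a monotone quasi-norm on the subspace `Y` of `L⁰(B)`. -/
structure IsMonotoneQuasiNorm (Y : Submodule ℝ (LZero B)) (N : Y → ℝ) : Prop where
  nonneg : ∀ x, 0 ≤ N x
  eq_zero_iff : ∀ x, N x = 0 ↔ x = 0
  smul : ∀ (α : ℝ) (x : Y), N (α • x) = |α| * N x
  add_le : ∃ C : ℝ, 1 ≤ C ∧ ∀ x y, N (x + y) ≤ C * (N x + N y)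
  monotone : ∀ x y : Y, |(y : LZero B)| ≤ |(x : LZero B)| → N y ≤ N x

/-- A linear map `δ : X → Y` from an ideal `X` of `C(Q)` to a subspace `Y` of `L⁰(B)` is a
derivation if `δ(xy) = δ(x) y + x δ(y)` in `L⁰(B)` for all `x, y ∈ X`. -/
def IsDerivationOn {X : Ideal C(StoneSpace B, ℝ)} {Y : Submodule ℝ (LZero B)}
    (δ : X →ₗ[ℝ] Y) : Prop :=
  ∀ x y : X, (δ ⟨(x : C(StoneSpace B, ℝ)) * y, X.mul_mem_left _ y.2⟩ : LZero B) =
    (δ x : LZero B) * CInfty.ofReal (y : C(StoneSpace B, ℝ)) +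
      CInfty.ofReal (x : C(StoneSpace B, ℝ)) * (δ y : LZero B)

/-- `δ` is band preserving if `s(δ(x)) ≤ s(x)` for all `x ∈ X`. -/
def IsBandPreserving {X : Ideal C(StoneSpace B, ℝ)} {Y : Submodule ℝ (LZero B)}
    (δ : X →ₗ[ℝ] Y) : Prop :=
  ∀ x : X, supp (δ x : LZero B) ≤ supp (CInfty.ofReal (x : C(StoneSpace B, ℝ)))

end

/-! Reduction to `C(Q)`: if `δ x ≠ 0`, band preservation gives a point where both `δ x` and `x` are
nonzero (`exists_ne_zero_of_supp_le`). On a clopen neighbourhood of it `x` is invertible, so its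
characteristic function `p` lies in `X` and `f ↦ δ (p * f)` is a derivation on all of `C(Q)` with
values in `Y`. It sends `x` to `p * δ x ≠ 0`, so it suffices that such derivations vanish
(`IsExtDerivation.eq_zero`).

A derivation `D` kills idempotents, hence commutes with restriction to clopen sets. Subtracting a
locally constant sign from `2z` keeps it in the unit ball while doubling `D z`, so `D` takes the
values `2 ^ n • D z` on the unit ball (`exists_two_pow`). If `D z ≠ 0`, the open set where it is
nonzero is infinite, since `D z` vanishes at isolated points, and so contains infinitely many
disjoint nonempty clopen sets. Extremal disconnectedness allows gluing a different, rapidly growing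
power of two on each (`exists_glue`). The glued function `v` has `D v` dominating pieces of
arbitrarily large quasi-norm, which is impossible. -/

/-- The characteristic function of a clopen set, as a continuous real function. -/
noncomputable def clopenChar {Q : Type u} [TopologicalSpace Q] (K : Set Q) (hK : IsClopen K) :
    C(Q, ℝ) :=
  ⟨K.indicator 1, continuous_one.indicator (by simp [hK.frontier_eq])⟩

/-! ### Characteristic functions of clopen sets and ideals -/

section ClopenChar

variable {Q : Type u} [TopologicalSpace Q] {K : Set Q} (hK : IsClopen K)

theorem clopenChar_of_mem {t : Q} (ht : t ∈ K) : clopenChar K hK t = 1 :=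
  indicator_of_mem ht _

theorem clopenChar_of_notMem {t : Q} (ht : t ∉ K) : clopenChar K hK t = 0 :=
  indicator_of_notMem ht _

theorem clopenChar_mul_self : clopenChar K hK * clopenChar K hK = clopenChar K hK := by
  ext t
  by_cases ht : t ∈ K
  · simp [clopenChar_of_mem hK ht]
  · simp [clopenChar_of_notMem hK ht]

/-- The characteristic function of a clopen set on which `x` does not vanish is a multiple
of `x`. -/
theorem clopenChar_mem_ideal {X : Ideal C(Q, ℝ)} {x : C(Q, ℝ)} (hx : x ∈ X)
    (h : ∀ t ∈ K, x t ≠ 0) : clopenChar K hK ∈ X := by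
  -- This denominator is `x` on `K` and `1` off `K`, so the quotient below is `1 / x` cut off to
  -- `K`.
  have hne : ∀ t, x t * clopenChar K hK t + (1 - clopenChar K hK t) ≠ 0 := by
    intro t
    by_cases ht : t ∈ K
    · simpa [clopenChar_of_mem hK ht] using h t ht
    · simp [clopenChar_of_notMem hK ht]
  let g : C(Q, ℝ) := ⟨fun t => clopenChar K hK t /
    (x t * clopenChar K hK t + (1 - clopenChar K hK t)),
    (map_continuous _).div (by fun_prop) hne⟩
  have : clopenChar K hK = g * x := by
    ext t
    by_cases ht : t ∈ K
    · simp [g, clopenChar_of_mem hK ht, h t ht]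
    · simp [g, clopenChar_of_notMem hK ht]
  rw [this]
  exact X.mul_mem_left _ hx

end ClopenChar

/-! ### Cutting elements of `C_∞(Q)` down to clopen sets -/

namespace CInfty

variable {Q : Type u} [TopologicalSpace Q]

theorem zero_apply (t : Q) : (0 : CInfty Q) t = 0 := rfl

theorem abs_apply [CompactSpace Q] [T2Space Q] [ExtremallyDisconnected Q] (x : CInfty Q) (t : Q) :
    |x| t = x t ⊔ -x t := rfl

theorem isOpen_ne_zero (x : CInfty Q) : IsOpen {t | x t ≠ 0} :=
  isOpen_ne_fun x.continuous_toFun continuous_const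

theorem exists_ne_zero {x : CInfty Q} (hx : x ≠ 0) : ∃ t, x t ≠ 0 := by
  by_contra! h
  exact hx (ext h)

variable [CompactSpace Q] [T2Space Q] [ExtremallyDisconnected Q]

/-- The product is specified only where `x` is finite; density of the finite points in `K` and
continuity carry the formula to the infinite points as well. -/
theorem clopenChar_mul_of_mem {K : Set Q} (hK : IsClopen K) (x : CInfty Q) {t : Q} (ht : t ∈ K) :
    (ofReal (clopenChar K hK) * x) t = x t := by
  have hcl : IsClosed {s | (ofReal (clopenChar K hK) * x) s = x s} :=
    isClosed_eq (continuous_toFun _) (continuous_toFun _)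
  refine hcl.closure_subset_iff.2 ?_ (x.dense_finSet.open_subset_closure_inter hK.isOpen ht)
  rintro s ⟨hs, hsx⟩
  rw [mem_ofPred_eq, mul_apply _ _ (by simp [finSet]) hsx]
  simp [clopenChar_of_mem hK hs, coe_toReal hsx]

theorem clopenChar_mul_of_notMem {K : Set Q} (hK : IsClopen K) (x : CInfty Q) {t : Q}
    (ht : t ∉ K) : (ofReal (clopenChar K hK) * x) t = 0 := by
  have hcl : IsClosed {s | (ofReal (clopenChar K hK) * x) s = 0} :=
    isClosed_eq (continuous_toFun _) continuous_const
  refine hcl.closure_subset_iff.2 ?_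
    (x.dense_finSet.open_subset_closure_inter hK.compl.isOpen ht)
  rintro s ⟨hs, hsx⟩
  rw [mem_ofPred_eq, mul_apply _ _ (by simp [finSet]) hsx]
  simp [clopenChar_of_notMem hK hs]

/-- Used twice later: solidity puts the cut-down element in `Y`, and monotonicity bounds its
quasi-norm. -/
theorem abs_clopenChar_mul_le {K : Set Q} (hK : IsClopen K) (x : CInfty Q) :
    |ofReal (clopenChar K hK) * x| ≤ |x| := by
  intro t
  rw [abs_apply, abs_apply]
  by_cases ht : t ∈ K
  · rw [clopenChar_mul_of_mem hK x ht]
  · rw [clopenChar_mul_of_notMem hK x ht]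
    rcases le_total 0 (x t) with h | h
    · simpa using Or.inl h
    · simpa using Or.inr h

end CInfty

/-! ### Gluing over an extremally disconnected space -/

section Extension

variable {Q : Type u} [TopologicalSpace Q] [CompactSpace Q] [T2Space Q] [ExtremallyDisconnected Q]

/-- Functions bounded by one can be glued along a disjoint family of open sets. -/
theorem exists_glue {ι : Type*} {U : ι → Set Q} (hU : ∀ i, IsOpen (U i))
    (hd : Pairwise (Function.onFun Disjoint U)) {z : ι → C(Q, ℝ)} (hz : ∀ i t, |z i t| ≤ 1) :
    ∃ y : C(Q, ℝ), ∀ i, ∀ t ∈ U i, y t = z i t := by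
  classical
  let V : Set Q := ⋃ i, U i
  have hV : IsOpen V := isOpen_iUnion hU
  -- The default `0` makes `g` continuous on the exterior of the union as well, hence on the dense
  -- open set `W`.
  let g : Q → ℝ := fun t => if h : ∃ i, t ∈ U i then z h.choose t else 0
  have hgU : ∀ i, ∀ t ∈ U i, g t = z i t := by
    intro i t ht
    have h : ∃ i, t ∈ U i := ⟨i, ht⟩
    have : h.choose = i := by
      by_contra hne
      exact disjoint_left.1 (hd hne) h.choose_spec ht
    simp only [g, dif_pos h, this]
  have hg0 : ∀ t ∉ V, g t = 0 := fun t ht => dif_neg (by simpa [V] using ht)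
  have hgb : ∀ t, |g t| ≤ 1 := by
    intro t
    by_cases ht : t ∈ V
    · obtain ⟨i, hi⟩ := mem_iUnion.1 ht
      rw [hgU i t hi]; exact hz i t
    · simp [hg0 t ht]
  let W : Set Q := V ∪ (closure V)ᶜ
  have hW : IsOpen W := hV.union isClosed_closure.isOpen_compl
  have hWd : Dense W := by
    intro t
    by_cases ht : t ∈ closure V
    · exact closure_mono subset_union_left ht
    · exact subset_closure (Or.inr ht)
  have hg : ContinuousOn g W := by
    rintro t (ht | ht)
    · obtain ⟨i, hi⟩ := mem_iUnion.1 ht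
      refine ((z i).continuous.continuousAt.congr ?_).continuousWithinAt
      filter_upwards [(hU i).mem_nhds hi] with s hs using (hgU i s hs).symm
    · refine ((continuousAt_const (y := (0 : ℝ))).congr ?_).continuousWithinAt
      filter_upwards [isClosed_closure.isOpen_compl.mem_nhds ht] with s hs
      exact (hg0 s fun h => hs (subset_closure h)).symm
  obtain ⟨f, hf⟩ := CInfty.exists_extension hW hWd hg
  -- The extension could a priori be infinite off `W`; the uniform bound passes to it by density and
  -- makes it a real function.
  have hfb : ∀ t, f t ∈ Icc (((-1 : ℝ) : EReal)) ((1 : ℝ) : EReal) := by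
    intro t
    refine (isClosed_Icc.preimage f.continuous_toFun).closure_subset_iff.2 ?_ (hWd t)
    intro s hs
    rw [mem_preimage, hf s hs, mem_Icc, EReal.coe_le_coe_iff, EReal.coe_le_coe_iff]
    exact abs_le.1 (hgb s)
  have hfin : ∀ t, t ∈ f.finSet := fun t =>
    ⟨((EReal.bot_lt_coe _).trans_le (hfb t).1).ne', ((hfb t).2.trans_lt (EReal.coe_lt_top _)).ne⟩
  refine ⟨⟨fun t => (f t).toReal, ?_⟩, fun i t ht => ?_⟩
  · rw [← continuousOn_univ]
    exact f.continuousOn_toReal.mono fun t _ => hfin t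
  · have hf' := hf t (Or.inl (mem_iUnion.2 ⟨i, ht⟩))
    simp only [ContinuousMap.coe_mk, hf', EReal.toReal_coe]
    exact hgU i t ht

/-! ### Derivations on `C(Q)`: locality and amplification -/

/-- A derivation from `C(Q)` to `C_∞(Q)`. -/
structure IsExtDerivation (D : C(Q, ℝ) →ₗ[ℝ] CInfty Q) : Prop where
  leibniz : ∀ f g, D (f * g) = D f * CInfty.ofReal g + CInfty.ofReal f * D g

namespace IsExtDerivation

variable {D : C(Q, ℝ) →ₗ[ℝ] CInfty Q}

/-- The Leibniz rule gives `D p = 2 p D p`; multiplying by `p` yields `p D p = 0`, hence `D p = 0`.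
-/
theorem map_idempotent (hD : IsExtDerivation D) {p : C(Q, ℝ)} (hp : p * p = p) : D p = 0 := by
  have h := hD.leibniz p p
  rw [hp] at h
  have hpp : CInfty.ofReal p * CInfty.ofReal p = CInfty.ofReal p := by
    rw [← CInfty.ofReal_mul, hp]
  have h2 : CInfty.ofReal p * D p = 0 := by
    linear_combination (-CInfty.ofReal p) * h - 2 * D p * hpp
  rw [h, mul_comm, h2, add_zero]

/-- Locality: on a clopen set, `D f` depends only on `f` there. -/
theorem map_idempotent_mul (hD : IsExtDerivation D) {p : C(Q, ℝ)} (hp : p * p = p) (f : C(Q, ℝ)) :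
    D (p * f) = CInfty.ofReal p * D f := by
  rw [hD.leibniz, hD.map_idempotent hp, zero_mul, zero_add]

theorem exists_double (hD : IsExtDerivation D) {z : C(Q, ℝ)} (hz : ∀ t, |z t| ≤ 1) :
    ∃ y : C(Q, ℝ), (∀ t, |y t| ≤ 1) ∧ D y = (2 : ℝ) • D z := by
  have ho : IsOpen {t | 0 < z t} := isOpen_lt continuous_const z.continuous
  have hK : IsClopen (closure {t | 0 < z t}) :=
    ⟨isClosed_closure, ExtremallyDisconnected.open_closure _ ho⟩
  -- `2p - 1` is a continuous sign of `z`: it is `1` where `z > 0` and `-1` where `z < 0`. The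
  -- witness applies `s ↦ 2s - 1` or `s ↦ 2s + 1` accordingly, each mapping its half of `[-1, 1]`
  -- onto `[-1, 1]`, and `D` does not see the sign.
  set p := clopenChar _ hK with hp
  refine ⟨(2 : ℝ) • z - ((2 : ℝ) • p - 1), fun t => ?_, ?_⟩
  · have hzt := abs_le.1 (hz t)
    by_cases ht : t ∈ closure {t | 0 < z t}
    · have h0 : 0 ≤ z t := closure_lt_subset_le continuous_const z.continuous ht
      have : p t = 1 := clopenChar_of_mem hK ht
      simp only [ContinuousMap.sub_apply, ContinuousMap.smul_apply, ContinuousMap.one_apply, this,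
        smul_eq_mul, abs_le]
      constructor <;> linarith
    · have h0 : z t ≤ 0 := not_lt.1 fun h => ht (subset_closure h)
      have : p t = 0 := clopenChar_of_notMem hK ht
      simp only [ContinuousMap.sub_apply, ContinuousMap.smul_apply, ContinuousMap.one_apply, this,
        smul_eq_mul, abs_le]
      constructor <;> linarith
  · rw [map_sub, map_sub, map_smul, map_smul, hD.map_idempotent (clopenChar_mul_self hK),
      hD.map_idempotent (mul_one 1), smul_zero, sub_zero, sub_zero]

theorem exists_two_pow (hD : IsExtDerivation D) {z : C(Q, ℝ)} (hz : ∀ t, |z t| ≤ 1) (n : ℕ) :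
    ∃ y : C(Q, ℝ), (∀ t, |y t| ≤ 1) ∧ D y = ((2 : ℝ) ^ n) • D z := by
  induction n with
  | zero => exact ⟨z, hz, by simp⟩
  | succ n ih =>
    obtain ⟨y, hy, hyD⟩ := ih
    obtain ⟨y', hy', hyD'⟩ := hD.exists_double hy
    exact ⟨y', hy', by rw [hyD', hyD, smul_smul, pow_succ']⟩

/-- At an isolated point `z` is locally a real multiple of an idempotent. -/
theorem apply_eq_zero_of_isOpen_singleton (hD : IsExtDerivation D) {t : Q} (ht : IsOpen {t}) (z : C(Q, ℝ)) :
    D z t = 0 := by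
  have hK : IsClopen {t} := ⟨isClosed_singleton, ht⟩
  have hz : clopenChar _ hK * z = z t • clopenChar _ hK := by
    ext s
    by_cases hs : s = t
    · subst hs; simp [clopenChar_of_mem hK (mem_singleton s)]
    · simp [clopenChar_of_notMem hK (show s ∉ {t} from hs)]
  have h := hD.map_idempotent_mul (clopenChar_mul_self hK) z
  rw [hz, map_smul, hD.map_idempotent (clopenChar_mul_self hK), smul_zero] at h
  rw [← CInfty.clopenChar_mul_of_mem hK (D z) (mem_singleton t), ← h, CInfty.zero_apply]

/-- Points of a finite open set in a Hausdorff space are isolated, and `D z` vanishes at isolated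
points. -/
theorem infinite_ne_zero (hD : IsExtDerivation D) {z : C(Q, ℝ)} (hz : D z ≠ 0) : {t | D z t ≠ 0}.Infinite := by
  intro hfin
  obtain ⟨t, ht⟩ := CInfty.exists_ne_zero hz
  refine ht (hD.apply_eq_zero_of_isOpen_singleton ?_ z)
  have : {t} = {s | D z s ≠ 0} \ ({s | D z s ≠ 0} \ {t}) := by
    ext s
    simp only [mem_singleton_iff, Set.mem_sdiff, mem_ofPred_eq]
    constructor
    · rintro rfl; simp [ht]
    · rintro ⟨h1, h2⟩; by_contra h; exact h2 ⟨h1, h⟩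
  rw [this]
  exact (D z).isOpen_ne_zero.sdiff (hfin.subset sdiff_subset).isClosed

end IsExtDerivation

end Extension

/-! ### Vanishing of derivations on `C(Q)` with values in `Y` -/

/-- A derivation from `C(Q)` with values in a monotonely quasi-normed solid space vanishes. -/
theorem IsExtDerivation.eq_zero {B : Type u} [CompleteBooleanAlgebra B]
    {Y : Submodule ℝ (LZero B)} (hY : IsSolidSpace Y) {N : Y → ℝ} (hN : IsMonotoneQuasiNorm Y N)
    {D : C(StoneSpace B, ℝ) →ₗ[ℝ] LZero B} (hD : IsExtDerivation D) (hDY : ∀ f, D f ∈ Y) :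
    D = 0 := by
  -- By linearity the unit ball suffices; scaling by `‖f‖ + 1` avoids dividing by zero.
  suffices H : ∀ z : C(StoneSpace B, ℝ), (∀ t, |z t| ≤ 1) → D z = 0 by
    ext1 f
    have hpos : 0 < ‖f‖ + 1 := by positivity
    have h := H ((‖f‖ + 1)⁻¹ • f) fun t => by
      rw [ContinuousMap.smul_apply, smul_eq_mul, abs_mul, abs_of_pos (inv_pos.2 hpos),
        inv_mul_le_iff₀ hpos, mul_one]
      exact (f.norm_coe_le_norm t).trans (by linarith)
    rw [map_smul] at h
    exact (smul_eq_zero.1 h).resolve_left (inv_pos.2 hpos).ne'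
  intro z hz
  by_contra hne
  have : Infinite {t | D z t ≠ 0} := (hD.infinite_ne_zero hne).to_subtype
  obtain ⟨U, hUinf, hUo, hUd⟩ := exists_seq_infinite_isOpen_pairwise_disjoint {t | D z t ≠ 0}
  have hE : ∀ k, ∃ e : B, (StoneSpace.basic e).Nonempty ∧
      StoneSpace.basic e ⊆ Subtype.val '' U k := by
    intro k
    obtain ⟨t, ht⟩ := (hUinf k).nonempty
    obtain ⟨e, he, hs⟩ := StoneSpace.exists_basic_subset
      ((D z).isOpen_ne_zero.isOpenMap_subtype_val _ (hUo k)) (mem_image_of_mem _ ht)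
    exact ⟨e, ⟨_, he⟩, hs⟩
  choose e hen heU using hE
  have hed : Pairwise (Function.onFun Disjoint fun k => StoneSpace.basic (e k)) := fun i j hij =>
    ((disjoint_image_iff Subtype.val_injective).2 (hUd hij)).mono (heU i) (heU j)
  have hK := fun k => StoneSpace.isClopen_basic (e k)
  let χ : ℕ → C(StoneSpace B, ℝ) := fun k => clopenChar _ (hK k)
  have hmem : ∀ k f, CInfty.ofReal (χ k) * D f ∈ Y := fun k f =>
    hY.solid _ (hDY f) _ (CInfty.abs_clopenChar_mul_le (hK k) _)
  let w : ℕ → Y := fun k => ⟨CInfty.ofReal (χ k) * D z, hmem k z⟩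
  have hw : ∀ k, 0 < N (w k) := by
    intro k
    refine (hN.nonneg _).lt_of_ne' fun h => ?_
    have h0 : CInfty.ofReal (χ k) * D z = 0 := congrArg Subtype.val ((hN.eq_zero_iff _).1 h)
    obtain ⟨t, ht⟩ := hen k
    obtain ⟨s, -, rfl⟩ := heU k ht
    refine s.2 ?_
    rw [← CInfty.clopenChar_mul_of_mem (hK k) (D z) ht]
    exact congrArg (fun x : LZero B => x s) h0
  -- The exponent is chosen so that `2 ^ n • w k` has quasi-norm above `k`.
  have hn : ∀ k : ℕ, ∃ n : ℕ, (k : ℝ) / N (w k) < 2 ^ n := fun k =>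
    pow_unbounded_of_one_lt _ one_lt_two
  choose n hn using hn
  choose y hy hyD using fun k => hD.exists_two_pow hz (n k)
  obtain ⟨v, hv⟩ := exists_glue (fun k => (hK k).isOpen) hed hy
  -- By locality the piece of `D v` over the `k`-th clopen set is `2 ^ n k • w k`, and a piece has
  -- quasi-norm at most that of `D v`.
  have hbound : ∀ k : ℕ, (k : ℝ) ≤ N ⟨D v, hDY v⟩ := by
    intro k
    have hχ : χ k * v = χ k * y k := by
      ext t
      by_cases ht : t ∈ StoneSpace.basic (e k)
      · simp [hv k t ht]
      · simp [χ, clopenChar_of_notMem (hK k) ht]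
    have hχD : CInfty.ofReal (χ k) * D v = (2 : ℝ) ^ n k • (CInfty.ofReal (χ k) * D z) := by
      rw [← hD.map_idempotent_mul (clopenChar_mul_self (hK k)), hχ,
        hD.map_idempotent_mul (clopenChar_mul_self (hK k)), hyD,
        ← hD.map_idempotent_mul (clopenChar_mul_self (hK k)), ← map_smul, ← map_smul,
        ← hD.map_idempotent_mul (clopenChar_mul_self (hK k)), mul_smul_comm]
    have hle := hN.monotone ⟨D v, hDY v⟩ ⟨CInfty.ofReal (χ k) * D v, hmem k v⟩
      (CInfty.abs_clopenChar_mul_le (hK k) _)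
    have heq : (⟨CInfty.ofReal (χ k) * D v, hmem k v⟩ : Y) = (2 : ℝ) ^ n k • w k :=
      Subtype.ext hχD
    rw [heq, hN.smul, abs_of_pos (by positivity)] at hle
    exact ((div_lt_iff₀ (hw k)).1 (hn k)).le.trans hle
  obtain ⟨k, hk⟩ := exists_nat_gt (N ⟨D v, hDY v⟩)
  exact (hbound k).not_gt hk

/-! ### Supports in terms of pointwise values -/

section Support

variable {B : Type u} [CompleteBooleanAlgebra B]

theorem idem_eq_ofReal_clopenChar (e : B) :
    idem e = CInfty.ofReal (clopenChar _ (StoneSpace.isClopen_basic e)) := rfl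

theorem idem_mul_eq_zero_iff {e : B} {x : LZero B} :
    idem e * x = 0 ↔ ∀ t ∈ StoneSpace.basic e, x t = 0 := by
  rw [idem_eq_ofReal_clopenChar]
  constructor
  · intro h t ht
    rw [← CInfty.clopenChar_mul_of_mem (StoneSpace.isClopen_basic e) x ht, h, CInfty.zero_apply]
  · intro h
    ext t
    by_cases ht : t ∈ StoneSpace.basic e
    · rw [CInfty.clopenChar_mul_of_mem _ x ht, h t ht, CInfty.zero_apply]
    · rw [CInfty.clopenChar_mul_of_notMem _ x ht, CInfty.zero_apply]

/-- If `s(w) ≤ s(x)` and `w ≠ 0` then `w` and `x` are simultaneously nonzero somewhere. -/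
theorem exists_ne_zero_of_supp_le {w x : LZero B} (h : supp w ≤ supp x) (hw : w ≠ 0) :
    ∃ t, w t ≠ 0 ∧ x t ≠ 0 := by
  by_contra! hx
  obtain ⟨t, ht⟩ := CInfty.exists_ne_zero hw
  obtain ⟨e, hte, he⟩ := StoneSpace.exists_basic_subset w.isOpen_ne_zero ht
  have hle : e ≤ sSup {b : B | idem b * w = 0} :=
    (le_sSup (show e ∈ {b : B | idem b * x = 0} from
      idem_mul_eq_zero_iff.2 fun s hs => hx s (he hs))).trans (compl_le_compl_iff_le.1 h)
  -- By distributivity `e` is the supremum of its meets with idempotents killing `w`; each meet is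
  -- `⊥`, since `w` has no zero on `basic e`.
  have hbot : e = ⊥ := by
    rw [← inf_eq_left.2 hle, inf_sSup_eq]
    refine iSup₂_eq_bot.2 fun b hb => ?_
    by_contra hne
    obtain ⟨s, hs⟩ := StoneSpace.exists_mem_basic hne
    simp only [StoneSpace.mem_basic, StoneSpace.val_inf, Bool.and_eq_true] at hs
    exact he hs.1 (idem_mul_eq_zero_iff.1 hb s hs.2)
  simp [hbot] at hte

end Support

/-! ### Reduction from an ideal to `C(Q)` -/

theorem mainTheorem2 {B : Type*} [CompleteBooleanAlgebra B]
    (X : Ideal C(StoneSpace B, ℝ)) (Y : Submodule ℝ (LZero B)) (hY : IsSolidSpace Y)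
    (N : Y → ℝ) (hN : IsMonotoneQuasiNorm Y N)
    (δ : X →ₗ[ℝ] Y) (hδ : IsDerivationOn δ) (hband : IsBandPreserving δ) :
    δ = 0 := by
  ext1 x
  by_contra hne
  have hw : (δ x : LZero B) ≠ 0 := fun h => hne (Subtype.ext h)
  obtain ⟨t, ht, hxt⟩ := exists_ne_zero_of_supp_le (hband x) hw
  obtain ⟨e, hte, he⟩ := StoneSpace.exists_basic_subset (CInfty.isOpen_ne_zero _) hxt
  have hK := StoneSpace.isClopen_basic e
  set p := clopenChar _ hK
  have hp : p ∈ X := clopenChar_mem_ideal hK x.2 fun s hs h => he hs (by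
    rw [CInfty.ofReal_apply, h, EReal.coe_zero])
  have hpp : p * p = p := clopenChar_mul_self hK
  -- Multiplying by `p ∈ X` brings every `f` into the ideal, so `D` is defined on all of `C(Q)`.
  let D : C(StoneSpace B, ℝ) →ₗ[ℝ] LZero B :=
    { toFun := fun f => (δ ⟨p * f, X.mul_mem_right f hp⟩ : LZero B)
      map_add' := fun f g => by
        rw [← Submodule.coe_add, ← map_add]
        exact congrArg (fun a => (δ a : LZero B)) (Subtype.ext (mul_add p f g))
      map_smul' := fun c f => by
        rw [RingHom.id_apply, ← Submodule.coe_smul, ← map_smul]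
        exact congrArg (fun a => (δ a : LZero B)) (Subtype.ext (mul_smul_comm c p f)) }
  have hδ' : ∀ (f g : C(StoneSpace B, ℝ)) (hf : f ∈ X) (hg : g ∈ X) (h : C(StoneSpace B, ℝ))
      (hh : h ∈ X), h = f * g → (δ ⟨h, hh⟩ : LZero B) =
        (δ ⟨f, hf⟩ : LZero B) * CInfty.ofReal g + CInfty.ofReal f * (δ ⟨g, hg⟩ : LZero B) := by
    rintro f g hf hg h hh rfl
    exact hδ ⟨f, hf⟩ ⟨g, hg⟩
  have hPP : CInfty.ofReal p * CInfty.ofReal p = CInfty.ofReal p := by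
    rw [← CInfty.ofReal_mul, hpp]
  have hδp : (δ ⟨p, hp⟩ : LZero B) = 0 := by
    have h := hδ' p p hp hp p hp hpp.symm
    have h2 : CInfty.ofReal p * (δ ⟨p, hp⟩ : LZero B) = 0 := by
      linear_combination (-CInfty.ofReal p) * h - 2 * (δ ⟨p, hp⟩ : LZero B) * hPP
    rw [h, mul_comm, h2, add_zero]
  have hmul : ∀ (f : C(StoneSpace B, ℝ)) (hf : f ∈ X),
      D f = CInfty.ofReal p * (δ ⟨f, hf⟩ : LZero B) := by
    intro f hf
    have h := hδ' p f hp hf (p * f) (X.mul_mem_right f hp) rfl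
    rwa [hδp, zero_mul, zero_add] at h
  -- `D f` lives on the clopen set of `p`; this absorbs the extra factors `p` in the Leibniz rule
  -- for `(p * f) * (p * g)`.
  have hDp : ∀ f, D f = CInfty.ofReal p * D f := fun f => by
    have h := hmul (p * f) (X.mul_mem_right f hp)
    refine Eq.trans ?_ h
    exact congrArg (fun a => (δ a : LZero B)) (Subtype.ext (by
      change p * f = p * (p * f)
      rw [← mul_assoc, hpp]))
  have hD : IsExtDerivation D := ⟨fun f g => by
    have h := hδ' (p * f) (p * g) (X.mul_mem_right f hp) (X.mul_mem_right g hp) (p * (f * g))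
      (X.mul_mem_right _ hp) (by linear_combination (-(f * g)) * hpp)
    change D (f * g) = D f * _ + _ * D g at h
    rw [h, CInfty.ofReal_mul, CInfty.ofReal_mul]
    linear_combination (-CInfty.ofReal g) * hDp f - CInfty.ofReal f * hDp g⟩
  have hD0 := hD.eq_zero hY hN fun f => (δ ⟨p * f, X.mul_mem_right f hp⟩).2
  -- `D x` is `p * δ x`, which agrees with `δ x` at `t`, where the latter is nonzero.
  have h0 := hmul x x.2
  rw [hD0, LinearMap.zero_apply] at h0
  refine ht ?_
  rw [← CInfty.clopenChar_mul_of_mem hK (δ x : LZero B) hte]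
  exact congrArg (fun a : LZero B => a t) h0.symm
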